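/- Let $\Sigma$ be an alphabet with exactly two letters. For a regular language $L\subseteq\Sigma^*$ let $\operatorname{sc}(L)$ be the smallest number of states of a complete deterministic finite automaton recognizing $L$, and let $$\operatorname{root}(L)=\{w\in\Sigma^* : w^m\in L \text{ for some } m\ge 1\}.$$ (i) For every integer $n\ge 7$ there is a regular language $L\subseteq\Sigma^*$ with $\operatorname{sc}(L)\le n$ such that $\operatorname{root}(L)$ is regular and $$\operatorname{sc}(\operatorname{root}(L))\;\ge\; n^n\left(1-\sqrt2\left(\frac2e\right)^{n/2}e^{1/12}-\sqrt8\,\frac1{\sqrt n}\,e^{1/12}\right)-\binom n2 .$$ (ii) Consequently, over a binary alphabet the blow-up can approach $n^n$: there are regular languages $L_n\subseteq\Sigma^*$ $(n\ge 7)$ with $\operatorname{sc}(L_n)=n$ and $\operatorname{root}(L_n)$ regular such that $$\lim_{n\to\infty}\frac{\operatorname{sc}(\operatorname{root}(L_n))}{n^n}=1 .$$ -/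

import Mathlib

/-- The root of a language: all words `w` such that some power `w ^ m` with `m ≥ 1`
(the concatenation of `m` copies of `w`) lies in `L`. -/
def rootLanguage {α : Type*} (L : Language α) : Language α :=
  {w : List α | ∃ m : ℕ, 1 ≤ m ∧ (List.replicate m w).flatten ∈ L}

/-- The state complexity of a regular language: the least number of states of a (complete)
deterministic finite automaton recognizing it. Up to renaming the states, a DFA with `m` states
has state set `Fin m`. The value is only meaningful for regular languages, for which the set
below is nonempty. -/
noncomputable def stateComplexity {α : Type*} (L : Language α) : ℕ :=
  sInf {m : ℕ | ∃ M : DFA α (Fin m), M.accepts = L}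

/-!
The state complexity of `root L` is governed by the transformation monoid of an automaton for `L`.
If `M` has states `Fin n` and accepts exactly at its start state `s`, then a word inducing the
self-map `f` lies in the root if and only if some positive power of `f` fixes `s`. Hence the root is
recognized by an automaton with state set `Fin n → Fin n`, of size `n ^ n`; conversely, a lower
bound needs a two-generated monoid that is almost all of `Fin n → Fin n` and whose elements are
separated by the root.

Generation. Choose disjoint `A` and `B` with `|A| = k`, `|B| = k + 1`, `2k + 1 ≤ n ≤ 2k + 4` and
`n - k` even. One letter rotates `A` and `B` as two cycles; as `k` and `k + 1` are coprime, its
powers contain both rotations separately. The other letter merges a point `b₀ ∈ B` into a point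
`a₀ ∈ A` and then applies a permutation `σ` fixing `b₀`. On maps avoiding `b₀` it acts as `σ`, and
together with the rotation of `A` the permutation `σ` generates all permutations fixing `b₀`.
Adding one further merge gives all self-maps of the complement of `b₀`, and rotating before and
after gives every map that identifies a point of `A` with a point of `B` and misses a point of `B`
(`exists_generators`). These are the `mergingMaps`.

Separation. Two distinct maps `f`, `g` can be told apart by composing with a map sending one point
to `s` and all others to a common `x ≠ s`, except when `f` is `s ↦ a`, rest `↦ b` and `g` is
`s ↦ b`, rest `↦ a` (`exists_returns_iff_not`). Discarding one map of every such pair costs at most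
`n.choose 2` (`mergingMaps_card_le_stateComplexity`).

Counting. For a uniformly random map the events `γ a = γ b` with `a ∈ A` and `b ∈ B` are pairwise
independent of probability `1 / n`, so by Chebyshev's inequality none of them happens with
probability at most `(n - 1) / (k (k + 1))` (`card_noCollision_mul_le`). A union bound over the
sections of `B` shows that `B` is contained in the range with probability at most
`n (n - 1) ⋯ (n - k) / n ^ (k + 1)` (`card_subset_range_le`). The two together are at most
`√8 / √n` for `n ≥ 13` (`badFraction_le`), whereas for `n ≤ 12` the bound of the first part is
not positive. The limit follows by squeezing.
-/

/-! ### Generating almost all self-maps of a finite set by two of them -/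

section Generation

open Equiv

/-- In a finite group, the inverse of an element is one of its powers. -/
theorem Submonoid.inv_mem_of_finite_group {G : Type*} [Group G] [Finite G] (S : Submonoid G) {g : G}
    (hg : g ∈ S) : g⁻¹ ∈ S := by
  have h : g⁻¹ ∈ Submonoid.powers g := by
    rw [mem_powers_iff_mem_zpowers]
    exact inv_mem (Subgroup.mem_zpowers g)
  obtain ⟨m, hm⟩ := h
  rw [← hm]
  exact pow_mem hg m

theorem Function.update_id_ne {X : Type*} [DecidableEq X] {a b : X} (hab : a ≠ b) (x : X) :
    Function.update id b a x ≠ b := by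
  by_cases hx : x = b
  · subst hx; simpa using hab
  · simpa [Function.update_of_ne hx] using hx

/-- A set of self-maps of `X` is a transformation monoid if it contains the identity and is closed
under composition. -/
structure IsTransformationMonoid {X : Type*} (T : Set (X → X)) : Prop where
  id_mem : id ∈ T
  comp_mem : ∀ {f g : X → X}, f ∈ T → g ∈ T → f ∘ g ∈ T

namespace IsTransformationMonoid

variable {X : Type*} {T : Set (X → X)}

/-- The permutations that belong to a transformation monoid. -/
def perms (hT : IsTransformationMonoid T) : Submonoid (Perm X) where
  carrier := {π | ⇑π ∈ T}
  one_mem' := hT.id_mem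
  mul_mem' {π τ} hπ hτ := by simpa using hT.comp_mem (f := ⇑π) (g := ⇑τ) hπ hτ

variable [DecidableEq X]

/-- The permutations `π` fixing `b` for which `π` composed with the idempotent merging `b` into `a`
belongs to the monoid. -/
def stabPerms (hT : IsTransformationMonoid T) {a b : X} (hab : a ≠ b)
    (he : Function.update id b a ∈ T) : Submonoid (Perm X) where
  carrier := {π | π b = b ∧ ⇑π ∘ Function.update id b a ∈ T}
  one_mem' := ⟨rfl, he⟩
  mul_mem' := by
    rintro π τ ⟨hπ, hπT⟩ ⟨hτ, hτT⟩
    refine ⟨by simp [hπ, hτ], ?_⟩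
    convert hT.comp_mem hπT hτT using 1
    funext x
    have : τ (Function.update id b a x) ≠ b := fun h =>
      Function.update_id_ne hab x (τ.injective (h.trans hτ.symm))
    simp [Function.update_of_ne this]

/-- Write `e` for the idempotent merging `b` into `a`. If `σ` fixes `b`, then `e ∘ σ ∘ e = σ ∘ e`, so the
`m`-th power of `σ ∘ e` is `σ ^ m ∘ e`, which is `e` when `m` is the order of `σ`. -/
theorem merge_mem_of_perm_comp_mem [Finite X] (hT : IsTransformationMonoid T) {a b : X} (hab : a ≠ b)
    {σ : Perm X} (hσ : σ b = b) (h : ⇑σ ∘ Function.update id b a ∈ T) :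
    Function.update id b a ∈ T := by
  have key : ∀ m : ℕ, ⇑(σ ^ (m + 1)) ∘ Function.update id b a ∈ T := by
    intro m
    induction m with
    | zero => simpa using h
    | succ m ih =>
      convert hT.comp_mem ih h using 1
      funext x
      have : σ (Function.update id b a x) ≠ b := fun h =>
        Function.update_id_ne hab x (σ.injective (h.trans hσ.symm))
      simp [Function.update_of_ne this, pow_succ _ (m + 1)]
  have h2 := key (orderOf σ - 1)
  rwa [Nat.sub_add_cancel (orderOf_pos σ), pow_orderOf_eq_one] at h2

end IsTransformationMonoid

/-- Transpositions forming a star on the complement of `b` generate all permutations fixing `b`. -/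
theorem Submonoid.mem_of_swap_star {X : Type*} [Fintype X] [DecidableEq X] (H : Submonoid (Perm X))
    {b c : X} (hc : ∀ y, y ≠ b → swap c y ∈ H) (π : Perm X) (hπ : π b = b) : π ∈ H := by
  have hswap : ∀ y z, y ≠ b → z ≠ b → swap y z ∈ H := by
    intro y z hy hz
    by_cases hyc : y = c
    · subst hyc; exact hc z hz
    by_cases hyz : y = z
    · subst hyz; rw [swap_self]; exact H.one_mem
    have := swap_mul_swap_mul_swap hyc hyz
    rw [swap_comm y, ← this]
    exact H.mul_mem (H.mul_mem (hc z hz) (swap_comm c y ▸ hc y hy)) (hc z hz)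
  induction hn : π.support.card using Nat.strong_induction_on generalizing π with
  | _ n ih =>
    by_cases h1 : π = 1
    · subst h1; exact H.one_mem
    obtain ⟨x, hx⟩ : ∃ x, π x ≠ x := by
      by_contra! h; exact h1 (Equiv.ext h)
    have hxb : x ≠ b := by rintro rfl; exact hx hπ
    have hπx : π x ≠ b := fun h => hxb (π.injective (h.trans hπ.symm))
    have := ih _ (hn ▸ Perm.card_support_swap_mul hx) (swap x (π x) * π)
      (by simp [hπ, swap_apply_of_ne_of_ne hxb.symm hπx.symm]) rfl
    have h2 := H.mul_mem (hswap x (π x) hxb hπx) this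
    rwa [← mul_assoc, swap_mul_self, one_mul] at h2

namespace IsTransformationMonoid
variable {X : Type*} [Fintype X] [DecidableEq X] {T : Set (X → X)}

/-- Suppose a transformation monoid contains, up to first merging `b` into `a`, all permutations fixing
`b`, and that it also merges some other point `b'` into `a`. Then it contains, up to first merging `b`
into `a`, every self-map preserving the complement of `b`. A map that is not injective is the
composite of a map of larger range with the merge of two points, which gives an induction on the
number of points outside the range. -/
theorem comp_merge_mem (hT : IsTransformationMonoid T) {a b b' : X} (hab : a ≠ b) (hbb : b' ≠ b)
    (hab' : a ≠ b')
    (hperm : ∀ π : Perm X, π b = b → ⇑π ∘ Function.update id b a ∈ T)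
    (hb' : Function.update id b' a ∈ T) (f : X → X) (hf : ∀ x, f x = b ↔ x = b) :
    f ∘ Function.update id b a ∈ T := by
  have hmul : ∀ f g : X → X, (∀ x, g x = b ↔ x = b) → f ∘ Function.update id b a ∈ T →
      g ∘ Function.update id b a ∈ T → (f ∘ g) ∘ Function.update id b a ∈ T := by
    intro f g hg hfT hgT
    convert hT.comp_mem hfT hgT using 1
    funext x
    have : g (Function.update id b a x) ≠ b := by
      rw [Ne, hg]
      exact Function.update_id_ne hab x
    simp [Function.update_of_ne this]
  have hpb : ∀ π : Perm X, π b = b → ∀ x, π x = b ↔ x = b := fun π hπ x =>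
    ⟨fun h => π.injective (h.trans hπ.symm), fun h => h ▸ hπ⟩
  have hmb : ∀ y z, y ≠ b → z ≠ b → ∀ x, Function.update id y z x = b ↔ x = b := by
    intro y z hy hz x
    by_cases hx : x = y
    · subst hx; simp [hz, hy]
    · simp [Function.update_of_ne hx]
  have hmerge : ∀ y z, y ≠ b → z ≠ b → y ≠ z →
      Function.update id y z ∘ Function.update id b a ∈ T := by
    intro y z hy hz hyz
    obtain ⟨π, hπb, hπy, hπz⟩ : ∃ π : Perm X, π b = b ∧ π b' = y ∧ π a = z := by
      have hc : swap b' y a ≠ y := by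
        intro h
        rw [swap_apply_eq_iff, swap_apply_right] at h
        exact hab' h
      have hcb : swap b' y a ≠ b := by
        intro h
        rw [swap_apply_eq_iff, swap_apply_of_ne_of_ne hbb.symm hy.symm] at h
        exact hab h
      refine ⟨swap (swap b' y a) z * swap b' y, ?_, ?_, ?_⟩
      · simp [swap_apply_of_ne_of_ne hbb.symm hy.symm, swap_apply_of_ne_of_ne hcb.symm hz.symm]
      · simp [swap_apply_of_ne_of_ne hc.symm hyz]
      · simp
    have hπb' : π⁻¹ b = b := by rw [Perm.inv_eq_iff_eq, hπb]
    have h1 := hmul π _ (hmb b' a hbb hab) (hperm π hπb)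
      (hT.comp_mem hb' (by simpa using hperm 1 rfl))
    have h2 := hmul _ _ (hpb _ hπb') h1 (hperm _ hπb')
    convert h2 using 2
    funext x
    by_cases hx : x = y
    · subst hx
      have : π⁻¹ x = b' := by rw [Perm.inv_eq_iff_eq, hπy]
      simp only [Function.comp_apply, this, Function.update_self, hπz]
    · have : π⁻¹ x ≠ b' := by rw [Ne, Perm.inv_eq_iff_eq, hπy]; exact hx
      simp only [Function.comp_apply, Function.update_of_ne this, Function.update_of_ne hx, id]
      exact (π.apply_symm_apply x).symm
  induction hn : (Finset.univ.image f)ᶜ.card using Nat.strong_induction_on generalizing f with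
  | _ n ih =>
    by_cases hinj : Function.Injective f
    · have hbij := Finite.injective_iff_bijective.1 hinj
      exact hperm (Equiv.ofBijective f hbij) ((hf b).2 rfl)
    have hsurj : ¬ Function.Surjective f := fun h => hinj (Finite.injective_iff_surjective.2 h)
    obtain ⟨w, hw⟩ : ∃ w, ∀ x, f x ≠ w := by simpa [Function.Surjective] using hsurj
    obtain ⟨y, z, hyz, hne⟩ : ∃ y z, f y = f z ∧ y ≠ z := by
      simpa [Function.Injective] using hinj
    have hyb : y ≠ b := by
      rintro rfl
      exact hne (((hf z).1 (hyz ▸ (hf y).2 rfl)).symm)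
    have hzb : z ≠ b := by
      rintro rfl
      exact hne ((hf y).1 (hyz ▸ (hf z).2 rfl))
    have hwb : w ≠ b := by
      rintro rfl
      exact hw w ((hf w).2 rfl)
    have hf' : ∀ x, Function.update f y w x = b ↔ x = b := by
      intro x
      by_cases hx : x = y
      · subst hx; simp [hwb, hyb]
      · simp [Function.update_of_ne hx, hf]
    -- Redirecting `y` to the missed value `w` enlarges the range, because `z` still attains `f y`.
    have hlt : (Finset.univ.image (Function.update f y w))ᶜ.card < n := by
      rw [← hn]
      apply Finset.card_lt_card
      rw [Finset.compl_ssubset_compl]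
      refine Finset.ssubset_iff_of_subset ?_ |>.2 ⟨w, ?_, ?_⟩
      · intro v hv
        simp only [Finset.mem_image, Finset.mem_univ, true_and] at hv ⊢
        obtain ⟨x, rfl⟩ := hv
        by_cases hx : x = y
        · exact ⟨z, by rw [Function.update_of_ne hne.symm, hx, hyz]⟩
        · exact ⟨x, by rw [Function.update_of_ne hx]⟩
      · simp only [Finset.mem_image, Finset.mem_univ, true_and]
        exact ⟨y, by simp⟩
      · simpa using hw
    have h3 := hmul _ _ (hmb y z hyb hzb) (ih _ hlt _ hf' rfl) (hmerge y z hyb hzb hne)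
    convert h3 using 2
    funext x
    by_cases hx : x = y
    · subst hx; simp [Function.update_of_ne hne.symm, hyz]
    · simp [Function.update_of_ne hx]

end IsTransformationMonoid

/-- The cycle of a list without repetitions acts transitively on the entries of the list. -/
theorem List.exists_formPerm_pow_eq {X : Type*} [DecidableEq X] {l : List X} (hl : l.Nodup) {x y : X}
    (hx : x ∈ l) (hy : y ∈ l) : ∃ m : ℕ, (l.formPerm ^ m) x = y := by
  obtain ⟨i, hi, rfl⟩ := List.getElem_of_mem hx
  obtain ⟨j, hj, rfl⟩ := List.getElem_of_mem hy
  refine ⟨l.length - i + j, ?_⟩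
  rw [List.formPerm_pow_apply_getElem l hl]
  congr 1
  rw [show i + (l.length - i + j) = j + l.length by omega, Nat.add_mod_right, Nat.mod_eq_of_lt hj]

theorem List.formPerm_pow_apply_of_notMem {X : Type*} [DecidableEq X] {l : List X} {x : X}
    (hx : x ∉ l) (m : ℕ) : (l.formPerm ^ m) x = x :=
  Perm.pow_apply_eq_self_of_apply_eq_self (List.formPerm_apply_of_notMem hx) m

/-- Conjugating by a permutation that fixes `x` moves the other end of a transposition `swap x u`. -/
theorem Submonoid.swap_apply_mem {X : Type*} [Finite X] [DecidableEq X] (H : Submonoid (Perm X))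
    {x u : X} {π : Perm X} (hπ : π ∈ H) (hx : π x = x) (h : swap x u ∈ H) : swap x (π u) ∈ H := by
  have := H.mul_mem (H.mul_mem hπ h) (H.inv_mem_of_finite_group hπ)
  rwa [← swap_apply_apply, hx] at this

/-- Two self-maps generating every map that identifies a point of `A` with a point of `B` and misses a
point of `B`. -/
theorem exists_generators {X : Type*} [Fintype X] [DecidableEq X] (A B : Finset X)
    (hAB : Disjoint A B) (hB : B.card = A.card + 1) (hA : 2 ≤ A.card)
    (hpar : Even (Fintype.card X - A.card)) :
    ∃ f g : X → X, ∀ T : Set (X → X), IsTransformationMonoid T → f ∈ T → g ∈ T →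
      ∀ γ : X → X, (∃ a ∈ A, ∃ b ∈ B, γ a = γ b) → (∃ b ∈ B, ∀ x, γ x ≠ b) → γ ∈ T := by
  obtain ⟨a₀, ha₀, a₁, ha₁, ha⟩ := Finset.one_lt_card.1 hA
  obtain ⟨b₀, hb₀, c, hc, hbc⟩ := Finset.one_lt_card.1 (show 1 < B.card by omega)
  have hne : ∀ {a b}, a ∈ A → b ∈ B → a ≠ b := fun ha hb h =>
    Finset.disjoint_left.1 hAB ha (h ▸ hb)
  set rA : Perm X := A.toList.formPerm with hrA
  set rB : Perm X := B.toList.formPerm with hrB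
  have hAn : ∀ {y}, y ∉ A → y ∉ A.toList := fun h => by simpa using h
  have hBn : ∀ {y}, y ∉ B → y ∉ B.toList := fun h => by simpa using h
  set l : List X := a₁ :: (Finset.univ \ (A ∪ {b₀, c})).toList with hl
  have hlm : ∀ y, y ∈ l ↔ y = a₁ ∨ (y ∉ A ∧ y ≠ b₀ ∧ y ≠ c) := by
    intro y; simp [hl]; tauto
  have hlnd : l.Nodup := by
    rw [hl, List.nodup_cons]
    exact ⟨by simp [ha₁], Finset.nodup_toList _⟩
  -- The cycle through `l` has odd order, so that a power of `σ` below isolates its transposition.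
  have hlodd : Odd l.length := by
    have h1 : (A ∪ {b₀, c}).card = A.card + 2 := by
      rw [Finset.card_union_of_disjoint, Finset.card_pair hbc]
      rw [Finset.disjoint_left]
      intro y hy
      simp only [Finset.mem_insert, Finset.mem_singleton, not_or]
      exact ⟨hne hy hb₀, hne hy hc⟩
    have h2 := Finset.card_sdiff_of_subset (Finset.subset_univ (A ∪ {b₀, c}))
    have h3 := Finset.card_le_univ (A ∪ {b₀, c})
    rw [Finset.card_univ] at h2
    have h4 : l.length = Fintype.card X - A.card - 2 + 1 := by
      rw [hl, List.length_cons, Finset.length_toList, h2, h1]; omega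
    rw [h4]
    obtain ⟨m, hm⟩ := hpar
    exact ⟨m - 1, by omega⟩
  set τ : Perm X := l.formPerm with hτ
  set σ : Perm X := swap a₀ c * τ with hσ
  have ha₀l : a₀ ∉ l := by rw [hlm]; simp [ha, ha₀]
  have hcl : c ∉ l := by rw [hlm]; simp [(hne ha₁ hc).symm]
  have hbl : b₀ ∉ l := by rw [hlm]; simp [(hne ha₁ hb₀).symm]
  have hστ : Commute (swap a₀ c) τ := by
    apply Perm.Disjoint.commute
    intro y
    by_cases h1 : y = a₀
    · exact Or.inr (List.formPerm_apply_of_notMem (h1 ▸ ha₀l))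
    by_cases h2 : y = c
    · exact Or.inr (List.formPerm_apply_of_notMem (h2 ▸ hcl))
    exact Or.inl (swap_apply_of_ne_of_ne h1 h2)
  have hcomm : Commute rA rB := by
    apply Perm.Disjoint.commute
    intro y
    by_cases hy : y ∈ A
    · exact Or.inr (List.formPerm_apply_of_notMem
        (hBn (Finset.disjoint_left.1 hAB hy)))
    · exact Or.inl (List.formPerm_apply_of_notMem (hAn hy))
  refine ⟨⇑(rA * rB), ⇑σ ∘ Function.update id b₀ a₀, fun T hT hα hβ => ?_⟩
  -- The orders `k` and `k + 1` of the rotations give `rA = (rA * rB) ^ (k + 1)` and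
  -- `rB⁻¹ = (rA * rB) ^ k`.
  have hA1 : rA ^ A.card = 1 := by
    have := List.formPerm_pow_length_eq_one_of_nodup _ (Finset.nodup_toList A)
    rwa [Finset.length_toList] at this
  have hB1 : rB ^ (A.card + 1) = 1 := by
    have := List.formPerm_pow_length_eq_one_of_nodup _ (Finset.nodup_toList B)
    rwa [Finset.length_toList, hB] at this
  have hαm : rA * rB ∈ hT.perms := hα
  have hrAm : rA ∈ hT.perms := by
    have := pow_mem hαm (A.card + 1)
    rwa [hcomm.mul_pow, hB1, pow_succ, hA1, one_mul, mul_one] at this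
  have hrBm : rB ∈ hT.perms := by
    have := pow_mem hαm A.card
    rw [hcomm.mul_pow, hA1, one_mul] at this
    have h2 := hT.perms.inv_mem_of_finite_group this
    rwa [inv_eq_of_mul_eq_one_right (by rwa [← pow_succ])] at h2
  have hab := hne ha₀ hb₀
  have hσb : σ b₀ = b₀ := by
    simp only [hσ, Perm.mul_apply]
    rw [hτ, List.formPerm_apply_of_notMem hbl, swap_apply_of_ne_of_ne hab.symm hbc]
  have he := hT.merge_mem_of_perm_comp_mem hab hσb hβ
  set H := hT.stabPerms hab he with hH
  have hσH : σ ∈ H := ⟨hσb, hβ⟩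
  have hrAb : rA b₀ = b₀ := List.formPerm_apply_of_notMem
    (hAn fun h => hne h hb₀ rfl)
  have hrAH : rA ∈ H := ⟨hrAb, hT.comp_mem hrAm he⟩
  have hsw : swap a₀ c ∈ H := by
    have := pow_mem hσH l.length
    rw [hσ, hστ.mul_pow, hτ, List.formPerm_pow_length_eq_one_of_nodup _ hlnd, mul_one] at this
    obtain ⟨m, hm⟩ := hlodd
    rwa [hm, pow_succ, pow_mul, sq, swap_mul_self, one_pow, one_mul] at this
  have hτH : τ ∈ H := by
    have := H.mul_mem hsw hσH
    rwa [hσ, ← mul_assoc, swap_mul_self, one_mul] at this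
  have hstarA : ∀ y ∈ A, swap c y ∈ H := by
    intro y hy
    obtain ⟨m, hm⟩ := List.exists_formPerm_pow_eq (Finset.nodup_toList A)
      (Finset.mem_toList.2 ha₀) (Finset.mem_toList.2 hy)
    rw [← hm]
    refine H.swap_apply_mem (pow_mem hrAH m) ?_ (swap_comm a₀ c ▸ hsw)
    exact List.formPerm_pow_apply_of_notMem (hAn fun h => hne h hc rfl) m
  -- The star with centre `c`: `rA` moves the other end of `swap c a₀` through `A`, and `τ` moves
  -- that of `swap c a₁` through the points outside `A`.
  have hperm : ∀ π : Perm X, π b₀ = b₀ → ⇑π ∘ Function.update id b₀ a₀ ∈ T := by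
    intro π hπ
    refine (H.mem_of_swap_star (b := b₀) (c := c) (fun y hy => ?_) π hπ : π ∈ H).2
    by_cases hyA : y ∈ A
    · exact hstarA y hyA
    by_cases hyc : y = c
    · rw [hyc, swap_self]; exact H.one_mem
    obtain ⟨m, hm⟩ := List.exists_formPerm_pow_eq hlnd
      ((hlm a₁).2 (Or.inl rfl)) ((hlm y).2 (Or.inr ⟨hyA, hy, hyc⟩))
    rw [← hm]
    exact H.swap_apply_mem (pow_mem hτH m) (List.formPerm_pow_apply_of_notMem hcl m)
      (hstarA a₁ ha₁)
  have hrotB : ∀ b ∈ B, ∃ π ∈ hT.perms, π b₀ = b ∧ ∀ y ∉ B, π y = y := by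
    intro b hb
    obtain ⟨m, hm⟩ := List.exists_formPerm_pow_eq (Finset.nodup_toList B)
      (Finset.mem_toList.2 hb₀) (Finset.mem_toList.2 hb)
    exact ⟨rB ^ m, pow_mem hrBm m, hm, fun y hy =>
      List.formPerm_pow_apply_of_notMem (hBn hy) m⟩
  have hrotA : ∀ a ∈ A, ∃ π ∈ hT.perms, π a₀ = a ∧ ∀ y ∉ A, π y = y := by
    intro a ha
    obtain ⟨m, hm⟩ := List.exists_formPerm_pow_eq (Finset.nodup_toList A)
      (Finset.mem_toList.2 ha₀) (Finset.mem_toList.2 ha)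
    exact ⟨rA ^ m, pow_mem hrAm m, hm, fun y hy =>
      List.formPerm_pow_apply_of_notMem (hAn hy) m⟩
  have hAB' : ∀ {a}, a ∈ A → a ∉ B := fun h => Finset.disjoint_left.1 hAB h
  have hBA' : ∀ {b}, b ∈ B → b ∉ A := fun h => Finset.disjoint_right.1 hAB h
  have hc' : Function.update id c a₀ ∈ T := by
    obtain ⟨π, hπ, hπb, hπy⟩ := hrotB c hc
    have h1 := hT.comp_mem (hT.comp_mem hπ he) (hT.perms.inv_mem_of_finite_group hπ)
    convert h1 using 1
    funext y
    by_cases hy : y = c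
    · subst hy
      have : π⁻¹ y = b₀ := by rw [Perm.inv_eq_iff_eq, hπb]
      simp only [Function.comp_apply, this, Function.update_self, hπy _ (hAB' ha₀)]
    · have : π⁻¹ y ≠ b₀ := by rw [Ne, Perm.inv_eq_iff_eq, hπb]; exact hy
      simp only [Function.comp_apply, Function.update_of_ne this, Function.update_of_ne hy, id]
      exact (π.apply_symm_apply y).symm
  rintro γ ⟨a, haA, b, hbB, hγ⟩ ⟨b', hb'B, hb'⟩
  obtain ⟨π₁, hπ₁, hπ₁a, hπ₁y⟩ := hrotA a haA
  obtain ⟨π₂, hπ₂, hπ₂b, hπ₂y⟩ := hrotB b hbB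
  obtain ⟨π₃, hπ₃, hπ₃b, -⟩ := hrotB b' hb'B
  set ρ := π₁ * π₂ with hρ
  have hρm : ρ ∈ hT.perms := mul_mem hπ₁ hπ₂
  have hρa : ρ a₀ = a := by simp [hρ, hπ₂y _ (hAB' ha₀), hπ₁a]
  have hρb : ρ b₀ = b := by simp [hρ, hπ₂b, hπ₁y _ (hBA' hbB)]
  set γ' : X → X := ⇑π₃⁻¹ ∘ γ ∘ ⇑ρ with hγ'
  have hγ'b : ∀ x, γ' x ≠ b₀ := by
    intro x
    simp only [hγ', Function.comp_apply, Ne, Perm.inv_eq_iff_eq, hπ₃b]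
    exact hb' _
  -- After rotating, the identified points are `a₀`, `b₀` and the missed point is `b₀`, so the value
  -- of `γ'` at `b₀` may be changed to `b₀` before precomposing with the merge.
  have hγ'T : γ' ∈ T := by
    have := hT.comp_merge_mem hab hbc.symm (hne ha₀ hc) hperm hc' (Function.update γ' b₀ b₀) (by
      intro x
      by_cases hx : x = b₀
      · subst hx; simp
      · simp [hx, hγ'b])
    convert this using 1
    funext x
    by_cases hx : x = b₀
    · subst hx
      simp only [Function.comp_apply, Function.update_self, Function.update_of_ne hab]
      simp only [hγ', Function.comp_apply, hρa, hρb, hγ]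
    · simp [Function.update_of_ne hx]
  have h5 := hT.comp_mem (hT.comp_mem hπ₃ hγ'T) (hT.perms.inv_mem_of_finite_group hρm)
  convert h5 using 1
  funext x
  simp [hγ']

end Generation

/-! ### State complexity and the automaton of the root -/

theorem stateComplexity_le_card {α σ : Type*} [Fintype σ] (M : DFA α σ) :
    stateComplexity M.accepts ≤ Fintype.card σ :=
  Nat.sInf_le ⟨DFA.reindex (Fintype.equivFin σ) M, by simp⟩

/-- The easy half of the Myhill–Nerode theorem: words pairwise separated by right contexts reach distinct
states. -/
theorem card_le_stateComplexity {α ι : Type*} [Fintype ι] {L : Language α} (hL : L.IsRegular)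
    (w : ι → List α) (h : ∀ i j, i ≠ j → ∃ v, ¬(w i ++ v ∈ L ↔ w j ++ v ∈ L)) :
    Fintype.card ι ≤ stateComplexity L := by
  have hne : {m : ℕ | ∃ M : DFA α (Fin m), M.accepts = L}.Nonempty := by
    obtain ⟨σ, _, M, rfl⟩ := hL
    exact ⟨_, DFA.reindex (Fintype.equivFin σ) M, by simp⟩
  obtain ⟨M, hM⟩ := Nat.sInf_mem hne
  have hinj : Function.Injective fun i => M.eval (w i) := by
    intro i j hij
    by_contra hne
    obtain ⟨v, hv⟩ := h i j hne
    apply hv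
    have hmem : ∀ u, u ∈ L ↔ M.eval u ∈ M.accept := fun u => by rw [← DFA.mem_accepts, hM]
    simp only [DFA.eval] at hij hmem
    simp only [hmem, DFA.evalFrom_of_append, hij]
  simpa [stateComplexity] using Fintype.card_le_of_injective _ hinj

namespace DFA

variable {α σ : Type*}

/-- The set of self-maps of the state set that are induced by words. -/
def transitionMaps (M : DFA α σ) : Set (σ → σ) := {f | ∃ w, ∀ q, M.evalFrom q w = f q}

theorem isTransformationMonoid_transitionMaps (M : DFA α σ) :
    IsTransformationMonoid M.transitionMaps where
  id_mem := ⟨[], fun _ => rfl⟩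
  comp_mem := by
    rintro f g ⟨v, hv⟩ ⟨w, hw⟩
    exact ⟨w ++ v, fun q => by rw [evalFrom_of_append, hw, hv]; rfl⟩

/-- The automaton for the root of the language of `M`: it computes the self-map of the state set of
`M` that the input word induces, and accepts if some positive power of that self-map sends the start
state to an accepting state. -/
def root (M : DFA α σ) : DFA α (σ → σ) where
  step f c := fun q => M.step (f q) c
  start := id
  accept := {f | ∃ m : ℕ, 1 ≤ m ∧ f^[m] M.start ∈ M.accept}

theorem evalFrom_root (M : DFA α σ) (w : List α) (f : σ → σ) :
    M.root.evalFrom f w = fun q => M.evalFrom (f q) w := by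
  induction w generalizing f with
  | nil => rfl
  | cons c w ih => simp only [evalFrom_cons, ih]; rfl

theorem evalFrom_flatten_replicate (M : DFA α σ) (w : List α) (m : ℕ) (q : σ) :
    M.evalFrom q (List.replicate m w).flatten = (fun p => M.evalFrom p w)^[m] q := by
  induction m generalizing q with
  | zero => rfl
  | succ m ih =>
    rw [List.replicate_succ, List.flatten_cons, evalFrom_of_append, ih, Function.iterate_succ_apply]

theorem accepts_root (M : DFA α σ) : M.root.accepts = rootLanguage M.accepts := by
  ext w
  rw [mem_accepts, eval, evalFrom_root]
  simp only [rootLanguage]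
  change (∃ m : ℕ, 1 ≤ m ∧ _ ∈ M.accept) ↔ ∃ m : ℕ, 1 ≤ m ∧ _ ∈ M.accepts
  simp only [mem_accepts, eval, evalFrom_flatten_replicate]
  rfl

end DFA

/-! ### Separating self-maps by the root -/

/-- Some positive power of `f` fixes `s`. -/
def Returns {X : Type*} (s : X) (f : X → X) : Prop := ∃ m : ℕ, 1 ≤ m ∧ f^[m] s = s

theorem not_returns_of_apply_eq {X : Type*} {s x : X} {f : X → X} (hx : x ≠ s) (h1 : f s = x)
    (h2 : f x = x) : ¬ Returns s f := by
  rintro ⟨m, hm, h⟩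
  obtain ⟨m, rfl⟩ := Nat.exists_eq_succ_of_ne_zero (by omega : m ≠ 0)
  rw [Function.iterate_succ_apply, h1, Function.iterate_fixed h2] at h
  exact hx h

/-- Distinct maps `f` and `g` are separated, as regards returning to `s`, after composing with a map that
sends one point `c` to `s` and all others to a common `x ≠ s`, unless `f` and `g` are constant off
`s` and obtained from one another by exchanging their two values. -/
theorem exists_returns_iff_not {X : Type*} [DecidableEq X] {s : X} {f g : X → X} (hfg : f ≠ g)
    (hex : ¬ ((∀ x, x ≠ s → f x = g s) ∧ (∀ x, x ≠ s → g x = f s))) :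
    ∃ c x, x ≠ s ∧ ¬ (Returns s (Function.update (fun _ => x) c s ∘ f) ↔
      Returns s (Function.update (fun _ => x) c s ∘ g)) := by
  -- If `f s ≠ g s` and `g x ≠ f s`, send `f s` to `s` and the rest to `x`: then `f` returns at once,
  -- and `g` is absorbed at `x`.
  have key1 : ∀ f g : X → X, f s ≠ g s → ∀ x, x ≠ s → g x ≠ f s →
      Returns s (Function.update (fun _ => x) (f s) s ∘ f) ∧
      ¬ Returns s (Function.update (fun _ => x) (f s) s ∘ g) := by
    intro f g hs x hx hgx
    refine ⟨⟨1, le_rfl, by simp⟩, not_returns_of_apply_eq hx ?_ ?_⟩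
    · simp [Function.update_of_ne hs.symm]
    · simp [Function.update_of_ne hgx]
  -- If `f s = g s`, `f p ≠ g p` and `f p ≠ f s`, send `f p` to `s` and the rest to `p`: then `f`
  -- returns in two steps through `p`, and `g` is absorbed at `p`.
  have key2 : ∀ f g : X → X, f s = g s → ∀ p, p ≠ s → f p ≠ g p → f p ≠ f s →
      Returns s (Function.update (fun _ => p) (f p) s ∘ f) ∧
      ¬ Returns s (Function.update (fun _ => p) (f p) s ∘ g) := by
    intro f g hs p hp hfg hfp
    refine ⟨⟨2, by norm_num, ?_⟩, not_returns_of_apply_eq hp ?_ ?_⟩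
    · simp [Function.update_of_ne hfp.symm]
    · simp [← hs, Function.update_of_ne hfp.symm]
    · simp [Function.update_of_ne hfg.symm]
  by_cases hs : f s = g s
  · obtain ⟨p, hp⟩ := Function.ne_iff.1 hfg
    have hps : p ≠ s := by rintro rfl; exact hp hs
    by_cases hfp : f p = f s
    · obtain ⟨h1, h2⟩ := key2 g f hs.symm p hps hp.symm (by rw [← hs, ← hfp]; exact hp.symm)
      exact ⟨_, _, hps, fun h => h2 (h.2 h1)⟩
    · obtain ⟨h1, h2⟩ := key2 f g hs p hps hp hfp
      exact ⟨_, _, hps, fun h => h2 (h.1 h1)⟩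
  · rw [not_and_or] at hex
    push Not at hex
    obtain ⟨x, hx, hne⟩ | ⟨x, hx, hne⟩ := hex
    · obtain ⟨h1, h2⟩ := key1 g f (Ne.symm hs) x hx hne
      exact ⟨_, _, hx, fun h => h2 (h.2 h1)⟩
    · obtain ⟨h1, h2⟩ := key1 f g hs x hx hne
      exact ⟨_, _, hx, fun h => h2 (h.1 h1)⟩

theorem card_filter_lt_eq_choose (n : ℕ) :
    (Finset.univ.filter fun p : Fin n × Fin n => p.1 < p.2).card = n.choose 2 := by
  have h : (Finset.univ.filter fun p : Fin n × Fin n => p.1 < p.2) =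
      (Finset.univ : Finset (Fin n)).biUnion fun b => (Finset.Iio b) ×ˢ {b} := by
    ext ⟨a, b⟩; simp
  rw [h, Finset.card_biUnion]
  · simp only [Finset.card_product, Finset.card_singleton, mul_one, Fin.card_Iio]
    rw [Fin.sum_univ_eq_sum_range (fun i => i) n, Finset.sum_range_id, Nat.choose_two_right]
  · intro b _ b' _ hbb
    simp only [Function.onFun]
    rw [Finset.disjoint_left]
    rintro ⟨x, y⟩ h1 h2
    simp only [Finset.mem_product, Finset.mem_singleton] at h1 h2
    exact hbb (h1.2.symm.trans h2.2)

/-- The self-maps `γ` that identify an element of `A` with an element of `B` and whose range does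
not contain `B`. -/
def mergingMaps {n : ℕ} (A B : Finset (Fin n)) : Finset (Fin n → Fin n) :=
  Finset.univ.filter fun γ => (∃ a ∈ A, ∃ b ∈ B, γ a = γ b) ∧ ∃ b ∈ B, ∀ x, γ x ≠ b

/-- If `M` accepts exactly at its start state and its words induce all `mergingMaps A B`, then `M` is
minimal, and the root separates these maps after one of each exceptional pair is discarded. -/
theorem mergingMaps_card_le_stateComplexity {α : Type*} {n : ℕ} {A B : Finset (Fin n)}
    (hA : 2 ≤ A.card) (hB : 3 ≤ B.card) {M : DFA α (Fin n)} (hacc : M.accept = {M.start})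
    (hT : ∀ γ ∈ mergingMaps A B, γ ∈ M.transitionMaps) :
    stateComplexity M.accepts = n ∧
    (mergingMaps A B).card ≤ stateComplexity (rootLanguage M.accepts) + n.choose 2 := by
  set s := M.start with hs
  have hmem : ∀ w, w ∈ M.accepts ↔ M.evalFrom s w = s := by
    intro w; rw [DFA.mem_accepts, hacc]; rfl
  have hh : ∀ c x : Fin n, Function.update (fun _ => x) c s ∈ M.transitionMaps := by
    intro c x
    apply hT
    simp only [mergingMaps, Finset.mem_filter, Finset.mem_univ, true_and]
    obtain ⟨a, ha, hac⟩ := Finset.exists_mem_ne (by omega : 1 < A.card) c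
    obtain ⟨b, hb, hbc⟩ := Finset.exists_mem_ne (by omega : 1 < B.card) c
    refine ⟨⟨a, ha, b, hb, by simp [Function.update_of_ne hac, Function.update_of_ne hbc]⟩, ?_⟩
    obtain ⟨b', hb', hb''⟩ := Finset.exists_mem_notMem_of_card_lt_card
      (s := {x, s}) (t := B) (lt_of_le_of_lt Finset.card_le_two (by omega))
    simp only [Finset.mem_insert, Finset.mem_singleton, not_or] at hb''
    refine ⟨b', hb', fun y => ?_⟩
    by_cases hy : y = c
    · subst hy; simpa using Ne.symm hb''.2
    · simpa [Function.update_of_ne hy] using Ne.symm hb''.1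
  have hreg : M.accepts.IsRegular := ⟨Fin n, inferInstance, M, rfl⟩
  have hregr : (rootLanguage M.accepts).IsRegular :=
    ⟨Fin n → Fin n, inferInstance, M.root, M.accepts_root⟩
  constructor
  · apply le_antisymm
    · simpa using stateComplexity_le_card M
    · have hreach : ∀ q : Fin n, ∃ w, M.evalFrom s w = q := by
        intro q
        by_cases hq : q = s
        · exact ⟨[], hq.symm⟩
        · obtain ⟨w, hw⟩ := hh q q
          exact ⟨w, by rw [hw, Function.update_of_ne (Ne.symm hq)]⟩
      choose w hw using hreach
      have := card_le_stateComplexity hreg w (by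
        intro q q' hqq
        obtain ⟨x, hx⟩ : ∃ x, x ≠ s := by
          by_cases h : q = s
          · exact ⟨q', fun h' => hqq (h.trans h'.symm)⟩
          · exact ⟨q, h⟩
        obtain ⟨v, hv⟩ := hh q x
        refine ⟨v, fun h => ?_⟩
        rw [hmem, hmem, DFA.evalFrom_of_append, DFA.evalFrom_of_append, hw, hw, hv, hv,
          Function.update_self, Function.update_of_ne hqq.symm] at h
        exact hx (h.1 rfl))
      simpa using this
  -- `E` contains one map of each pair that `exists_returns_iff_not` does not separate.
  · set E : Finset (Fin n → Fin n) :=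
      (Finset.univ.filter fun p : Fin n × Fin n => p.1 < p.2).image
        fun p => Function.update (fun _ => p.2) s p.1 with hE
    have hEc : E.card ≤ n.choose 2 := by
      rw [← card_filter_lt_eq_choose]; exact Finset.card_image_le
    have hchoose : ∀ γ : {γ // γ ∈ mergingMaps A B \ E}, ∃ w, ∀ q, M.evalFrom q w = γ.1 q :=
      fun γ => hT _ (Finset.mem_sdiff.1 γ.2).1
    choose w hw using hchoose
    have hroot : ∀ (γ : {γ // γ ∈ mergingMaps A B \ E}) (v : List α) (h : Fin n → Fin n),
        (∀ q, M.evalFrom q v = h q) →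
        (w γ ++ v ∈ rootLanguage M.accepts ↔ Returns s (h ∘ γ.1)) := by
      intro γ v h hv
      change (∃ m : ℕ, 1 ≤ m ∧ _ ∈ M.accepts) ↔ _
      simp only [hmem, DFA.evalFrom_flatten_replicate, DFA.evalFrom_of_append, hw, hv]
      rfl
    have := card_le_stateComplexity hregr w (by
      intro γ δ hγδ
      obtain ⟨c, x, -, hcx⟩ := exists_returns_iff_not (s := s) (f := γ.1) (g := δ.1)
        (fun h => hγδ (Subtype.ext h)) (by
          rintro ⟨h1, h2⟩
          have h3 : γ.1 = Function.update (fun _ => δ.1 s) s (γ.1 s) := by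
            funext x
            by_cases hx : x = s
            · subst hx; simp
            · rw [Function.update_of_ne hx, h1 x hx]
          have h4 : δ.1 = Function.update (fun _ => γ.1 s) s (δ.1 s) := by
            funext x
            by_cases hx : x = s
            · subst hx; simp
            · rw [Function.update_of_ne hx, h2 x hx]
          rcases lt_trichotomy (γ.1 s) (δ.1 s) with hlt | heq | hlt
          · refine (Finset.mem_sdiff.1 γ.2).2 (Finset.mem_image.2 ⟨(γ.1 s, δ.1 s), ?_, h3.symm⟩)
            simpa using hlt
          · exact hγδ (Subtype.ext (by rw [h3, h4, heq]; simp))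
          · refine (Finset.mem_sdiff.1 δ.2).2 (Finset.mem_image.2 ⟨(δ.1 s, γ.1 s), ?_, h4.symm⟩)
            simpa using hlt)
      obtain ⟨v, hv⟩ := hh c x
      refine ⟨v, ?_⟩
      rwa [hroot γ v _ hv, hroot δ v _ hv])
    rw [Fintype.card_coe] at this
    have h5 := Finset.le_card_sdiff E (mergingMaps A B)
    omega

theorem exists_language_mergingMaps {α : Type*} [Fintype α] (hα : Fintype.card α = 2) {n k : ℕ}
    (hk : 2 ≤ k) (hkn : 2 * k + 1 ≤ n) (hpar : Even (n - k)) :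
    ∃ A B : Finset (Fin n), Disjoint A B ∧ A.card = k ∧ B.card = k + 1 ∧ ∃ L : Language α,
      L.IsRegular ∧ (rootLanguage L).IsRegular ∧ stateComplexity L = n ∧
      stateComplexity (rootLanguage L) ≤ n ^ n ∧
      (mergingMaps A B).card ≤ stateComplexity (rootLanguage L) + n.choose 2 := by
  classical
  obtain ⟨A, -, hA⟩ := Finset.exists_subset_card_eq
    (s := (Finset.univ : Finset (Fin n))) (n := k) (by simp; omega)
  obtain ⟨B, hBA, hB⟩ := Finset.exists_subset_card_eq (s := Aᶜ) (n := k + 1)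
    (by rw [Finset.card_compl, Fintype.card_fin]; omega)
  have hAB : Disjoint A B :=
    Finset.disjoint_left.2 fun x hx hx' => Finset.mem_compl.1 (hBA hx') hx
  obtain ⟨f, g, hfg⟩ := exists_generators A B hAB (by omega) (by omega) (by simpa [hA] using hpar)
  obtain ⟨c, d, hcd⟩ := Fintype.one_lt_card_iff.1 (hα ▸ one_lt_two)
  let s : Fin n := ⟨0, by omega⟩
  let M : DFA α (Fin n) := ⟨fun q e => if e = c then f q else g q, s, {s}⟩
  refine ⟨A, B, hAB, hA, hB, M.accepts, ⟨Fin n, inferInstance, M, rfl⟩,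
    ⟨Fin n → Fin n, inferInstance, M.root, M.accepts_root⟩, ?_⟩
  have hT := hfg M.transitionMaps M.isTransformationMonoid_transitionMaps
    ⟨[c], fun q => by simp [M]⟩ ⟨[d], fun q => by simp [M, Ne.symm hcd]⟩
  obtain ⟨h1, h2⟩ := mergingMaps_card_le_stateComplexity (M := M) (A := A) (B := B) (by omega)
    (by omega) rfl (fun γ hγ => by
      obtain ⟨h1, h2⟩ := (Finset.mem_filter.1 hγ).2
      exact hT γ h1 h2)
  refine ⟨h1, ?_, h2⟩
  rw [← DFA.accepts_root]
  simpa using stateComplexity_le_card M.root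

/-! ### Counting the self-maps that are generated -/

/-- The centred indicator of the event `γ a = γ b`: for `a ≠ b` and a uniformly random `γ` it has
mean zero. -/
noncomputable def collisionDeviation {n : ℕ} (a b : Fin n) (γ : Fin n → Fin n) : ℝ :=
  (if γ a = γ b then 1 else 0) - 1 / n

theorem collisionDeviation_comm {n : ℕ} (a b : Fin n) (γ : Fin n → Fin n) :
    collisionDeviation a b γ = collisionDeviation b a γ := by
  simp only [collisionDeviation, eq_comm]

/-- A function that does not depend on `γ a` is uncorrelated with the event `γ a = γ b`: averaging over
the translations of `γ a` makes the deviation vanish. -/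
theorem sum_mul_collisionDeviation_eq_zero {n : ℕ} [NeZero n] {a b : Fin n} (hab : a ≠ b)
    {F : (Fin n → Fin n) → ℝ} (hF : ∀ γ v, F (γ + Pi.single a v) = F γ) :
    ∑ γ, F γ * collisionDeviation a b γ = 0 := by
  have hn : (n : ℝ) ≠ 0 := Nat.cast_ne_zero.2 (NeZero.ne n)
  have h1 : ∀ v : Fin n, ∑ γ, F γ * collisionDeviation a b (γ + Pi.single a v) =
      ∑ γ, F γ * collisionDeviation a b γ := by
    intro v
    rw [← Equiv.sum_comp (Equiv.addRight (Pi.single a v))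
      (fun γ => F γ * collisionDeviation a b γ)]
    exact Finset.sum_congr rfl fun γ _ => by rw [Equiv.coe_addRight, hF]
  have h2 : ∀ γ : Fin n → Fin n, ∑ v, collisionDeviation a b (γ + Pi.single a v) = 0 := by
    intro γ
    have h3 : ∀ v : Fin n, (γ a + v = γ b) ↔ v = γ b - γ a := by
      intro v
      rw [eq_sub_iff_add_eq, add_comm]
    simp only [collisionDeviation, Pi.add_apply, Pi.single_eq_same, Pi.single_eq_of_ne hab.symm,
      add_zero, h3]
    rw [Finset.sum_sub_distrib, Finset.sum_ite_eq']
    simp [hn]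
  have h4 : (n : ℝ) * ∑ γ, F γ * collisionDeviation a b γ = 0 := by
    calc (n : ℝ) * ∑ γ, F γ * collisionDeviation a b γ
        = ∑ v : Fin n, ∑ γ, F γ * collisionDeviation a b (γ + Pi.single a v) := by
          simp [h1]
      _ = 0 := by
          rw [Finset.sum_comm]
          refine Finset.sum_eq_zero fun γ _ => ?_
          rw [← Finset.mul_sum, h2, mul_zero]
  exact (mul_eq_zero.1 h4).resolve_left hn

theorem collisionDeviation_add_single {n : ℕ} [NeZero n] {a b c : Fin n} (ha : a ≠ c) (hb : b ≠ c)
    (γ : Fin n → Fin n) (v : Fin n) :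
    collisionDeviation a b (γ + Pi.single c v) = collisionDeviation a b γ := by
  simp [collisionDeviation, Pi.single_eq_of_ne ha, Pi.single_eq_of_ne hb]

/-- Collisions of distinct pairs are uncorrelated, even if the pairs share a point. -/
theorem sum_collisionDeviation_mul_eq_zero {n : ℕ} [NeZero n] {a b a' b' : Fin n} (hab : a ≠ b)
    (hab' : a ≠ b') (ha'b : a' ≠ b) (hne : (a, b) ≠ (a', b')) :
    ∑ γ, collisionDeviation a' b' γ * collisionDeviation a b γ = 0 := by
  by_cases ha : a' = a
  · have hb : b' ≠ b := by rintro rfl; exact hne (by rw [ha])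
    simp only [collisionDeviation_comm a b]
    exact sum_mul_collisionDeviation_eq_zero hab.symm
      (collisionDeviation_add_single ha'b hb)
  · exact sum_mul_collisionDeviation_eq_zero hab (collisionDeviation_add_single ha hab'.symm)

theorem sum_collisionDeviation_sq {n : ℕ} [NeZero n] {a b : Fin n} (hab : a ≠ b) :
    ∑ γ, collisionDeviation a b γ * collisionDeviation a b γ = (n : ℝ) ^ n * (n - 1) / n ^ 2 := by
  have hn : (n : ℝ) ≠ 0 := Nat.cast_ne_zero.2 (NeZero.ne n)
  have h1 : ∀ γ : Fin n → Fin n, collisionDeviation a b γ * collisionDeviation a b γ =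
      (1 - 2 / n) * collisionDeviation a b γ + (1 / n - 1 / n ^ 2) := by
    intro γ
    unfold collisionDeviation
    split_ifs <;> field_simp <;> ring
  have h2 : ∑ γ, collisionDeviation a b γ = 0 := by
    simpa using sum_mul_collisionDeviation_eq_zero hab (F := fun _ => 1) (fun _ _ => rfl)
  simp only [h1, Finset.sum_add_distrib, ← Finset.mul_sum, h2]
  simp
  field_simp

/-- Chebyshev's inequality for the number of colliding pairs in `A × B`. -/
theorem card_noCollision_mul_le {n : ℕ} [NeZero n] {A B : Finset (Fin n)} (hAB : Disjoint A B)
    (hA : A.Nonempty) (hB : B.Nonempty) :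
    ((Finset.univ.filter fun γ : Fin n → Fin n => ∀ a ∈ A, ∀ b ∈ B, γ a ≠ γ b).card : ℝ) *
      (A.card * B.card) ≤ (n : ℝ) ^ n * (n - 1) := by
  have hn : (0 : ℝ) < n := Nat.cast_pos.2 (NeZero.pos n)
  have hA' : (0 : ℝ) < A.card := Nat.cast_pos.2 hA.card_pos
  have hB' : (0 : ℝ) < B.card := Nat.cast_pos.2 hB.card_pos
  have hne : ∀ {a b}, a ∈ A → b ∈ B → a ≠ b := fun ha hb h =>
    Finset.disjoint_left.1 hAB ha (h ▸ hb)
  set Z : (Fin n → Fin n) → ℝ := fun γ => ∑ p ∈ A ×ˢ B, collisionDeviation p.1 p.2 γ with hZ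
  have h1 : ∑ γ, Z γ ^ 2 = A.card * B.card * ((n : ℝ) ^ n * (n - 1) / n ^ 2) := by
    have hsq : ∀ γ, Z γ ^ 2 = ∑ p ∈ A ×ˢ B, ∑ q ∈ A ×ˢ B,
        collisionDeviation p.1 p.2 γ * collisionDeviation q.1 q.2 γ := fun γ => by
      rw [sq, Finset.sum_mul_sum]
    simp only [hsq]
    rw [Finset.sum_comm]
    have : ∀ p ∈ A ×ˢ B, ∑ γ, ∑ q ∈ A ×ˢ B,
        collisionDeviation p.1 p.2 γ * collisionDeviation q.1 q.2 γ =
        (n : ℝ) ^ n * (n - 1) / n ^ 2 := by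
      intro p hp
      obtain ⟨hp1, hp2⟩ := Finset.mem_product.1 hp
      rw [Finset.sum_comm, Finset.sum_eq_single_of_mem p hp,
        sum_collisionDeviation_sq (hne hp1 hp2)]
      intro q hq hqp
      obtain ⟨hq1, hq2⟩ := Finset.mem_product.1 hq
      exact sum_collisionDeviation_mul_eq_zero (hne hq1 hq2) (hne hq1 hp2) (hne hp1 hq2) hqp
    rw [Finset.sum_congr rfl this]
    simp [Finset.card_product]
  set S := Finset.univ.filter fun γ : Fin n → Fin n => ∀ a ∈ A, ∀ b ∈ B, γ a ≠ γ b with hS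
  have h2 : ∀ γ ∈ S, Z γ ^ 2 = (A.card * B.card / n) ^ 2 := by
    intro γ hγ
    have hγ' := (Finset.mem_filter.1 hγ).2
    have : Z γ = ∑ p ∈ A ×ˢ B, (-(1 / n) : ℝ) := by
      refine Finset.sum_congr rfl fun p hp => ?_
      obtain ⟨hp1, hp2⟩ := Finset.mem_product.1 hp
      simp [collisionDeviation, hγ' _ hp1 _ hp2]
    rw [this]
    simp [Finset.card_product]
    ring
  have h3 : (S.card : ℝ) * (A.card * B.card / n) ^ 2 ≤
      A.card * B.card * ((n : ℝ) ^ n * (n - 1) / n ^ 2) := by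
    rw [← h1, ← nsmul_eq_mul, ← Finset.sum_const, ← Finset.sum_congr rfl h2]
    exact Finset.sum_le_sum_of_subset_of_nonneg (Finset.subset_univ _) fun _ _ _ => sq_nonneg _
  have h4 : (0 : ℝ) < A.card * B.card / n ^ 2 := by positivity
  refine le_of_mul_le_mul_right ?_ h4
  calc _ = (S.card : ℝ) * (A.card * B.card / n) ^ 2 := by ring
    _ ≤ _ := h3
    _ = _ := by ring

/-- The union bound over all injective sections `B ↪ Fin n` of a map whose range contains `B`. -/
theorem card_subset_range_le {n : ℕ} (B : Finset (Fin n)) :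
    (Finset.univ.filter fun γ : Fin n → Fin n => ∀ b ∈ B, ∃ x, γ x = b).card ≤
      n.descFactorial B.card * n ^ (n - B.card) := by
  classical
  have hsub : (Finset.univ.filter fun γ : Fin n → Fin n => ∀ b ∈ B, ∃ x, γ x = b) ⊆
      (Finset.univ : Finset (B ↪ Fin n)).biUnion fun j =>
        Fintype.piFinset fun x => if h : ∃ b, j b = x then {h.choose.1} else Finset.univ := by
    intro γ hγ
    have hγ' := (Finset.mem_filter.1 hγ).2
    choose! i hi using hγ'
    rw [Finset.mem_biUnion]
    refine ⟨⟨fun b => i b.1, fun b b' h => Subtype.ext ?_⟩, Finset.mem_univ _, ?_⟩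
    · rw [← hi b b.2, ← hi b' b'.2]; exact congrArg γ h
    · rw [Fintype.mem_piFinset]
      intro x
      split_ifs with h
      · have h2 : i h.choose.1 = x := h.choose_spec
        have h3 := hi _ h.choose.2
        rw [h2] at h3
        exact Finset.mem_singleton.2 h3
      · exact Finset.mem_univ _
  refine (Finset.card_le_card hsub).trans (Finset.card_biUnion_le.trans ?_)
  have hcard : ∀ j : B ↪ Fin n, (Fintype.piFinset fun x : Fin n =>
      if h : ∃ b, j b = x then {h.choose.1} else (Finset.univ : Finset (Fin n))).card =
      n ^ (n - B.card) := by
    intro j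
    rw [Fintype.card_piFinset]
    have : ∀ x : Fin n, (if h : ∃ b, j b = x then {h.choose.1} else
        (Finset.univ : Finset (Fin n))).card = if x ∈ Finset.univ.map j then 1 else n := by
      intro x
      by_cases h : ∃ b, j b = x
      · rw [dif_pos h, if_pos (by simpa using h)]; simp
      · rw [dif_neg h, if_neg (by simpa using h)]; simp
    simp only [this]
    rw [Finset.prod_ite, Finset.prod_const_one, one_mul, Finset.prod_const,
      Finset.filter_not, Finset.card_sdiff_of_subset (Finset.filter_subset _ _)]
    have hfilter : Finset.univ.filter (fun x => x ∈ Finset.univ.map j) = Finset.univ.map j := by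
      ext; simp
    rw [hfilter, Finset.card_map, Finset.card_univ, Finset.card_univ, Fintype.card_coe,
      Fintype.card_fin]
  simp only [hcard]
  simp [Fintype.card_embedding_eq]

theorem le_card_mergingMaps {n k : ℕ} (hk : 1 ≤ k) {A B : Finset (Fin n)} (hAB : Disjoint A B)
    (hA : A.card = k) (hB : B.card = k + 1) :
    (n : ℝ) ^ n * (1 - (n - 1) / (k * (k + 1)) - n.descFactorial (k + 1) / n ^ (k + 1)) ≤
      (mergingMaps A B).card := by
  have hkn : k + 1 ≤ n := by
    rw [← hB]; simpa using Finset.card_le_univ B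
  have : NeZero n := ⟨by omega⟩
  have hn : (0 : ℝ) < n := Nat.cast_pos.2 (NeZero.pos n)
  have hk0 : (0 : ℝ) < k := Nat.cast_pos.2 hk
  set S := Finset.univ.filter fun γ : Fin n → Fin n => ∀ a ∈ A, ∀ b ∈ B, γ a ≠ γ b
  set R := Finset.univ.filter fun γ : Fin n → Fin n => ∀ b ∈ B, ∃ x, γ x = b
  have hS : (S.card : ℝ) ≤ (n : ℝ) ^ n * ((n - 1) / (k * (k + 1))) := by
    have := card_noCollision_mul_le hAB (Finset.card_pos.1 (by omega)) (Finset.card_pos.1 (by omega))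
    rw [hA, hB] at this
    rw [← mul_div_assoc, le_div_iff₀ (by positivity)]
    exact_mod_cast this
  have hR : (R.card : ℝ) ≤ (n : ℝ) ^ n * (n.descFactorial (k + 1) / n ^ (k + 1)) := by
    have h1 := card_subset_range_le B
    rw [hB] at h1
    have h2 : (R.card : ℝ) ≤ n.descFactorial (k + 1) * n ^ (n - (k + 1)) := by exact_mod_cast h1
    refine h2.trans_eq ?_
    have h3 : (n : ℝ) ^ n = n ^ (n - (k + 1)) * n ^ (k + 1) := by
      rw [← pow_add, Nat.sub_add_cancel hkn]
    rw [h3]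
    field_simp
  have hcover : (Finset.univ : Finset (Fin n → Fin n)) ⊆ mergingMaps A B ∪ (S ∪ R) := by
    intro γ _
    simp only [mergingMaps, S, R, Finset.mem_union, Finset.mem_filter, Finset.mem_univ, true_and]
    by_contra! h
    obtain ⟨h1, ⟨a, ha, b, hb, h2⟩, c, hc, h3⟩ := h
    obtain ⟨x, hx⟩ := h1 ⟨a, ha, b, hb, h2⟩ c hc
    exact h3 x hx
  have hle : n ^ n ≤ (mergingMaps A B).card + (S.card + R.card) := by
    have := (Finset.card_le_card hcover).trans
      ((Finset.card_union_le _ _).trans (Nat.add_le_add_left (Finset.card_union_le _ _) _))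
    simpa using this
  have hle' : (n : ℝ) ^ n ≤ (mergingMaps A B).card + (S.card + R.card) := by exact_mod_cast hle
  linarith

/-! ### Numerical estimates and conclusion -/

theorem descFactorial_div_pow_le {n l : ℕ} (hl : l ≤ n) :
    (n.descFactorial l : ℝ) / n ^ l ≤ 1 / (1 + l * (l - 1) / (2 * n)) := by
  rcases Nat.eq_zero_or_pos n with rfl | hn
  · obtain rfl : l = 0 := by omega
    simp
  have hn0 : (0 : ℝ) < n := Nat.cast_pos.2 hn
  have hS : ∀ m : ℕ, (0 : ℝ) ≤ m * (m - 1) / (2 * n) := by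
    intro m
    rcases Nat.eq_zero_or_pos m with rfl | hm
    · simp
    · have : (1 : ℝ) ≤ m := Nat.one_le_cast.2 hm
      exact div_nonneg (mul_nonneg (by linarith) (by linarith)) (by linarith)
  rw [le_div_iff₀ (by linarith [hS l])]
  induction l with
  | zero => simp
  | succ l ih =>
    have ih := ih (by omega)
    have hln : (l : ℝ) ≤ n := Nat.cast_le.2 (by omega)
    set P : ℝ := (n.descFactorial l : ℝ) / n ^ l with hP
    have hP0 : 0 ≤ P := by positivity
    have h1 : (n.descFactorial (l + 1) : ℝ) / n ^ (l + 1) = P * (1 - l / n) := by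
      rw [Nat.descFactorial_succ, Nat.cast_mul, Nat.cast_sub (by omega), hP, pow_succ]
      field_simp
    set S : ℝ := l * (l - 1) / (2 * n) with hSdef
    have h2 : ((l + 1 : ℕ) : ℝ) * ((l + 1 : ℕ) - 1) / (2 * n) = S + l / n := by
      rw [hSdef]; push_cast; field_simp; ring
    rw [h1, h2]
    set x : ℝ := l / n
    have hx0 : 0 ≤ x := by positivity
    have hS0 : 0 ≤ S := hS l
    calc P * (1 - x) * (1 + (S + x)) = P * (1 + S) - P * (x * S + x ^ 2) := by ring
      _ ≤ P * (1 + S) := by linarith [mul_nonneg hP0 (add_nonneg (mul_nonneg hx0 hS0) (sq_nonneg x))]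
      _ ≤ 1 := ih

theorem sqrt_eight_div_sqrt (n : ℕ) : √8 / √n = √(8 / n) :=
  (Real.sqrt_div (by norm_num) _).symm

theorem badFraction_le {n k : ℕ} (hn : 13 ≤ n) (hkn : 2 * k + 1 ≤ n) (hnk : n ≤ 2 * k + 4)
    (hpar : Even (n - k)) :
    ((n : ℝ) - 1) / (k * (k + 1)) + n.descFactorial (k + 1) / n ^ (k + 1) ≤ √8 / √n := by
  rw [sqrt_eight_div_sqrt]
  apply Real.le_sqrt_of_sq_le
  -- For `n ≥ 22` the sum is at most `13.2 / n`; for smaller `n` the hypotheses determine `k`.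
  by_cases hn' : 22 ≤ n
  · have h1 := descFactorial_div_pow_le (show k + 1 ≤ n by omega)
    have hn0 : (22 : ℝ) ≤ n := by exact_mod_cast hn'
    have hk0 : (9 : ℝ) ≤ k := by exact_mod_cast (by omega : 9 ≤ k)
    have hnk' : (n : ℝ) ≤ 2 * k + 4 := by exact_mod_cast hnk
    have hq : ((n : ℝ) - 4) * (n - 2) / 4 ≤ k * (k + 1) := by nlinarith
    have h2 : ((n : ℝ) - 1) / (k * (k + 1)) ≤ 5.2 / n := by
      rw [div_le_div_iff₀ (by positivity) (by positivity)]
      nlinarith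
    have hcast : ((k + 1 : ℕ) : ℝ) * ((k + 1 : ℕ) - 1) = k * (k + 1) := by push_cast; ring
    rw [hcast] at h1
    have h3 : 1 / (1 + (k : ℝ) * (k + 1) / (2 * n)) ≤ 8 / n := by
      rw [div_le_div_iff₀ (by positivity) (by positivity)]
      have : 8 * (1 + (k : ℝ) * (k + 1) / (2 * n)) = (8 * n + 4 * (k * (k + 1))) / n := by
        field_simp; ring
      rw [this, le_div_iff₀ (by positivity)]
      nlinarith
    have h4 : ((n : ℝ) - 1) / (k * (k + 1)) + n.descFactorial (k + 1) / n ^ (k + 1) ≤ 13.2 / n := by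
      have : (13.2 : ℝ) / n = 5.2 / n + 8 / n := by ring
      linarith
    have h5 : 0 ≤ ((n : ℝ) - 1) / (k * (k + 1)) + n.descFactorial (k + 1) / n ^ (k + 1) :=
      add_nonneg (div_nonneg (by linarith) (by positivity)) (by positivity)
    refine (pow_le_pow_left₀ h5 h4 2).trans ?_
    rw [div_pow, div_le_div_iff₀ (by positivity) (by positivity)]
    nlinarith
  · obtain ⟨m, hm⟩ := hpar
    push Not at hn'
    interval_cases n
    · obtain rfl : k = 5 := by omega
      norm_num [Nat.descFactorial]
    · obtain rfl : k = 6 := by omega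
      norm_num [Nat.descFactorial]
    · obtain rfl : k = 7 := by omega
      norm_num [Nat.descFactorial]
    · obtain rfl : k = 6 := by omega
      norm_num [Nat.descFactorial]
    · obtain rfl : k = 7 := by omega
      norm_num [Nat.descFactorial]
    · obtain rfl : k = 8 := by omega
      norm_num [Nat.descFactorial]
    · obtain rfl : k = 9 := by omega
      norm_num [Nat.descFactorial]
    · obtain rfl : k = 8 := by omega
      norm_num [Nat.descFactorial]
    · obtain rfl : k = 9 := by omega
      norm_num [Nat.descFactorial]

theorem exists_language {α : Type*} [Fintype α] (hα : Fintype.card α = 2) {n : ℕ} (hn : 7 ≤ n) :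
    ∃ L : Language α, L.IsRegular ∧ (rootLanguage L).IsRegular ∧ stateComplexity L = n ∧
      stateComplexity (rootLanguage L) ≤ n ^ n ∧
      (13 ≤ n → (n : ℝ) ^ n * (1 - √8 / √n) - n.choose 2 ≤ stateComplexity (rootLanguage L)) := by
  -- `k` is the largest number of the parity of `n` with `2k + 1 ≤ n`.
  obtain ⟨k, hk, hkn, hnk, hpar⟩ :
      ∃ k, 2 ≤ k ∧ 2 * k + 1 ≤ n ∧ n ≤ 2 * k + 4 ∧ Even (n - k) := by
    rcases Nat.even_or_odd' (n - (n - 1) / 2) with ⟨m, hm | hm⟩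
    · exact ⟨(n - 1) / 2, by omega, by omega, by omega, ⟨m, by omega⟩⟩
    · exact ⟨(n - 1) / 2 - 1, by omega, by omega, by omega, ⟨m + 1, by omega⟩⟩
  obtain ⟨A, B, hAB, hA, hB, L, hL, hrL, hsc, hle, hcard⟩ := exists_language_mergingMaps hα hk hkn hpar
  refine ⟨L, hL, hrL, hsc, hle, fun hn' => ?_⟩
  have h1 := le_card_mergingMaps (by omega) hAB hA hB
  have h2 : ((mergingMaps A B).card : ℝ) ≤ stateComplexity (rootLanguage L) + n.choose 2 := by
    exact_mod_cast hcard
  have h3 := badFraction_le hn' hkn hnk hpar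
  have h4 : (n : ℝ) ^ n * (1 - √8 / √n) ≤ (n : ℝ) ^ n *
      (1 - (n - 1) / (k * (k + 1)) - n.descFactorial (k + 1) / n ^ (k + 1)) :=
    mul_le_mul_of_nonneg_left (by linarith) (by positivity)
  linarith

/-- For `n ≤ 12` the lower bound of the first part is not positive. Both terms decrease in `n`, and at
`n = 12` they exceed `0.17` and `0.88`. -/
theorem one_le_error_of_le_twelve {n : ℕ} (hn0 : 1 ≤ n) (hn : n ≤ 12) :
    1 ≤ √2 * (2 / Real.exp 1) ^ ((n : ℝ) / 2) * Real.exp (1 / 12)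
      + √8 * (1 / √n) * Real.exp (1 / 12) := by
  have he : (13 / 12 : ℝ) ≤ Real.exp (1 / 12) := by
    have := Real.add_one_le_exp (1 / 12 : ℝ); linarith
  have h1 : (0.816 : ℝ) ≤ √8 * (1 / √n) := by
    rw [mul_one_div, sqrt_eight_div_sqrt]
    apply Real.le_sqrt_of_sq_le
    have h12 : (n : ℝ) ≤ 12 := by exact_mod_cast hn
    have h0 : (0 : ℝ) < n := by exact_mod_cast hn0
    rw [le_div_iff₀ h0]
    nlinarith
  have h2 : (0.158 : ℝ) ≤ (2 / Real.exp 1) ^ ((n : ℝ) / 2) := by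
    have hpos : 0 < 2 / Real.exp 1 := by positivity
    have hlt := Real.exp_one_lt_d9
    have hgt := Real.exp_one_gt_d9
    have h3 : (2 / Real.exp 1) ^ (6 : ℝ) ≤ (2 / Real.exp 1) ^ ((n : ℝ) / 2) := by
      apply Real.rpow_le_rpow_of_exponent_ge hpos
      · rw [div_le_one (by positivity)]; linarith
      · have h12 : (n : ℝ) ≤ 12 := by exact_mod_cast hn
        linarith
    refine le_trans ?_ h3
    have h4 : (2 / 2.72 : ℝ) ≤ 2 / Real.exp 1 :=
      div_le_div_of_nonneg_left (by norm_num) (by positivity) (by linarith)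
    have h5 := pow_le_pow_left₀ (by norm_num) h4 6
    rw [show (6 : ℝ) = ((6 : ℕ) : ℝ) by norm_num, Real.rpow_natCast]
    refine le_trans ?_ h5
    norm_num
  have h3 : (1 : ℝ) ≤ √2 := Real.one_le_sqrt.2 (by norm_num)
  have h4 : (0.158 : ℝ) ≤ √2 * (2 / Real.exp 1) ^ ((n : ℝ) / 2) := by nlinarith
  rw [← add_mul]
  nlinarith

theorem corollary3p21 {α : Type*} [Fintype α] (hα : Fintype.card α = 2) :
    (∀ n : ℕ, 7 ≤ n → ∃ L : Language α,
      L.IsRegular ∧ (rootLanguage L).IsRegular ∧ stateComplexity L ≤ n ∧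
      (stateComplexity (rootLanguage L) : ℝ) ≥
        (n : ℝ) ^ n *
          (1 - Real.sqrt 2 * (2 / Real.exp 1) ^ ((n : ℝ) / 2) * Real.exp (1 / 12)
            - Real.sqrt 8 * (1 / Real.sqrt n) * Real.exp (1 / 12))
          - (n.choose 2 : ℝ)) ∧
    ∃ L : ℕ → Language α,
      (∀ n : ℕ, 7 ≤ n →
        (L n).IsRegular ∧ (rootLanguage (L n)).IsRegular ∧ stateComplexity (L n) = n) ∧
      Filter.Tendsto (fun n : ℕ => (stateComplexity (rootLanguage (L n)) : ℝ) / (n : ℝ) ^ n)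
        Filter.atTop (nhds 1) := by
  have hex : ∀ n : ℕ, ∃ L : Language α, 7 ≤ n → L.IsRegular ∧ (rootLanguage L).IsRegular ∧
      stateComplexity L = n ∧ stateComplexity (rootLanguage L) ≤ n ^ n ∧
      (13 ≤ n → (n : ℝ) ^ n * (1 - √8 / √n) - n.choose 2 ≤ stateComplexity (rootLanguage L)) := by
    intro n
    by_cases hn : 7 ≤ n
    · obtain ⟨L, hL⟩ := exists_language hα hn
      exact ⟨L, fun _ => hL⟩
    · exact ⟨⊥, fun h => absurd h hn⟩
  choose L hL using hex
  refine ⟨fun n hn => ?_, L, fun n hn => ?_, ?_⟩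
  · obtain ⟨hreg, hroot, hsc, -, hlow⟩ := hL n hn
    refine ⟨L n, hreg, hroot, hsc.le, ?_⟩
    by_cases hn' : 13 ≤ n
    · refine le_trans ?_ (hlow hn')
      have h1 : 0 ≤ √2 * (2 / Real.exp 1) ^ ((n : ℝ) / 2) * Real.exp (1 / 12) := by positivity
      have h2 : √8 / √n ≤ √8 * (1 / √n) * Real.exp (1 / 12) := by
        rw [mul_one_div]
        exact le_mul_of_one_le_right (by positivity) (Real.one_le_exp (by norm_num))
      gcongr ?_ * ?_ - _
      linarith
    · have h1 := one_le_error_of_le_twelve (n := n) (by omega) (by omega)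
      have h2 : (n : ℝ) ^ n *
          (1 - √2 * (2 / Real.exp 1) ^ ((n : ℝ) / 2) * Real.exp (1 / 12)
            - √8 * (1 / √n) * Real.exp (1 / 12)) ≤ 0 :=
        mul_nonpos_of_nonneg_of_nonpos (by positivity) (by linarith)
      have h3 : (0 : ℝ) ≤ n.choose 2 := Nat.cast_nonneg _
      have h4 : (0 : ℝ) ≤ stateComplexity (rootLanguage (L n)) := Nat.cast_nonneg _
      linarith
  · obtain ⟨hreg, hroot, hsc, -⟩ := hL n hn
    exact ⟨hreg, hroot, hsc⟩
  · have hlim : Filter.Tendsto (fun n : ℕ => 1 - √8 / √n - 1 / (n : ℝ)) Filter.atTop (nhds 1) := by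
      have h1 : Filter.Tendsto (fun n : ℕ => √8 / √(n : ℝ)) Filter.atTop (nhds 0) :=
        tendsto_const_nhds.div_atTop (Real.tendsto_sqrt_atTop.comp tendsto_natCast_atTop_atTop)
      have h2 := tendsto_one_div_atTop_nhds_zero_nat (𝕜 := ℝ)
      simpa using (tendsto_const_nhds (x := (1 : ℝ))).sub h1 |>.sub h2
    refine tendsto_of_tendsto_of_tendsto_of_le_of_le' hlim tendsto_const_nhds ?_ ?_
    · filter_upwards [Filter.eventually_ge_atTop 13] with n hn
      obtain ⟨-, -, -, -, hlow⟩ := hL n (by omega)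
      have hn0 : (0 : ℝ) < n := by exact_mod_cast (by omega : 0 < n)
      rw [le_div_iff₀ (by positivity)]
      refine le_trans ?_ (hlow hn)
      have h1 : (n.choose 2 : ℝ) ≤ 1 / n * n ^ n := by
        have h2 : (n.choose 2 : ℝ) ≤ n ^ 2 := by exact_mod_cast Nat.choose_le_pow n 2
        have h3 : (n : ℝ) ^ 3 ≤ n ^ n :=
          pow_le_pow_right₀ (by exact_mod_cast (by omega : 1 ≤ n)) (by omega)
        rw [one_div_mul_eq_div, le_div_iff₀ hn0]
        nlinarith
      linarith
    · filter_upwards [Filter.eventually_ge_atTop 7] with n hn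
      obtain ⟨-, -, -, hle, -⟩ := hL n hn
      have hn0 : (0 : ℝ) < n := by exact_mod_cast (by omega : 0 < n)
      rw [div_le_one (by positivity)]
      exact_mod_cast hle
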